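/- Let $q$ be a prime power, $v\ge 0$ and $d$ integers. A full flag in $\mathbb{F}_q^v$ is a chain $\Lambda=(W_1<\dots<W_{v-1})$ of subspaces of $\mathbb{F}_q^v$ with $\dim W_i=i$; the Grassmann distance of two full flags is $\mathrm{d}_{\mathrm G}(\Lambda,\Lambda')=\sum_{i=1}^{v-1}\bigl(i-\dim(W_i\cap W_i')\bigr)$, and $A_q^f(v,d)$ is the maximum cardinality of a set of full flags in $\mathbb{F}_q^v$ any two distinct members of which have Grassmann distance at least $d$. Write $m(v)_i=\min\{i,v-i\}$ for $1\le i\le v-1$, and $\binom{n}{k}_q=\prod_{i=1}^{k}\frac{q^{n-k+i}-1}{q^i-1}$ for the Gaussian binomial coefficient. Let $r\in\mathbb{Z}^{v-1}$ satisfy $0\le r_i\le m(v)_i$ for all $i$. Put $u_i=i-m(v)_i+r_i$, $$\overline{u}_j=\max\bigl(\{u_i\mid 1\le i\le j\}\cup\{u_i-2(i-j)\mid j<i<v\}\bigr),\qquad \overline{r}_j=\overline{u}_j-j+m(v)_j ,$$ and $\mathcal I=\{1\le i\le v-1\mid r_i>0\}=\{k_1<\dots<k_m\}$. Assume that $d>\sum_{i=1}^{v-1}\bigl(m(v)_i-\overline{r}_i\bigr)$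 and that $u_{k_1}\le u_{k_2}\le\dots\le u_{k_m}$. Call a family $(U_i)_{i\in\mathcal I}$ of subspaces of $\mathbb{F}_q^v$ weakly increasing if $U_i\le U_j$ for all $i\le j$ in $\mathcal I$. Let $\mathcal U$ be the set of weakly increasing families $(U_i)_{i\in\mathcal I}$ with $\dim U_i=u_i$ for all $i\in\mathcal I$, and, for an arbitrary but fixed full flag $\Lambda'=(W_1',\dots,W_{v-1}')$ in $\mathbb{F}_q^v$, let $\widehat{\mathcal U}$ be the set of those $(U_i)_{i\in\mathcal I}\in\mathcal U$ with $U_i\le W_i'$ for all $i\in\mathcal I$. Then $\widehat{\mathcal U}\neq\emptyset$, $$A_q^f(v,d)\le\frac{\#\mathcal U}{\#\widehat{\mathcal U}},$$ and $$\frac{\#\mathcal U}{\#\widehat{\mathcal U}}=\frac{\binom{v}{u_{k_1}}_q\cdot\prod_{i=2}^{m}\binom{v-u_{k_{i-1}}}{u_{k_i}-u_{k_{i-1}}}_q}{\binom{k_1}{u_{k_1}}_q\cdot\prod_{i=2}^{m}\binom{k_i-u_{k_{i-1}}}{u_{k_i}-u_{k_{i-1}}}_q},$$ where for $\mathcal I=\emptyset$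 the right-hand side is read as $1$. -/

import Mathlib

namespace FlagCode

/-- The index set `{1, …, v - 1}`. -/
abbrev Idx (v : ℕ) := {i : ℕ // i ∈ Finset.Ioo 0 v}

/-- A full flag `W_1 < W_2 < ⋯ < W_{v-1}` in `K ^ v`, with `dim W_i = i`. -/
@[ext]
structure FullFlag (K : Type*) [Field K] (v : ℕ) where
  W : Idx v → Submodule K (Fin v → K)
  strictMono : StrictMono W
  finrank_eq : ∀ i : Idx v, Module.finrank K (W i) = (i : ℕ)

instance {K : Type*} [Field K] [Finite K] (v : ℕ) : Finite (FullFlag K v) :=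
  Finite.of_injective (fun L : FullFlag K v => L.W) fun _ _ h => FullFlag.ext h

/-- The Grassmann distance `∑ (i - dim (W_i ∩ W'_i))` of two full flags
(the subtraction never truncates, since `dim W_i = i`). -/
noncomputable def grassmannDist {K : Type*} [Field K] {v : ℕ} (L L' : FullFlag K v) : ℕ :=
  ∑ i : Idx v, ((i : ℕ) - Module.finrank K (L.W i ⊓ L'.W i : Submodule K (Fin v → K)))

/-- The minimum Grassmann distance of a full flag code; it is `∞` for codes with fewer than two
codewords. -/
noncomputable def minDist {K : Type*} [Field K] {v : ℕ} (C : Set (FullFlag K v)) : ℕ∞ :=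
  ⨅ (L ∈ C) (L' ∈ C) (_ : L ≠ L'), (grassmannDist L L' : ℕ∞)

/-- `A_q^f(v, d)` for `K = 𝔽_q`: the maximum cardinality of a full flag code in `K ^ v` with
minimum Grassmann distance at least `d`. -/
noncomputable def maxCode (K : Type*) [Field K] (v d : ℕ) : ℕ :=
  sSup {n : ℕ | ∃ C : Set (FullFlag K v), C.ncard = n ∧ (d : ℕ∞) ≤ minDist C}

/-- Over a finite field the supremum in `maxCode` is a maximum. -/
theorem isGreatest_maxCode (K : Type*) [Field K] [Finite K] (v d : ℕ) :
    IsGreatest {n : ℕ | ∃ C : Set (FullFlag K v), C.ncard = n ∧ (d : ℕ∞) ≤ minDist C}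
      (maxCode K v d) := by
  have hb : BddAbove {n : ℕ | ∃ C : Set (FullFlag K v), C.ncard = n ∧ (d : ℕ∞) ≤ minDist C} := by
    refine ⟨(Set.univ : Set (FullFlag K v)).ncard, ?_⟩
    rintro n ⟨C, rfl, -⟩
    exact Set.ncard_le_ncard (Set.subset_univ C)
  refine ⟨Nat.sSup_mem ⟨0, ∅, by simp, by simp [minDist]⟩ hb, fun n hn => le_csSup hb hn⟩

/-- The vector `m(v)`, with entries `m(v)_i = min {i, v - i}`. -/
def mVec (v : ℕ) (i : Idx v) : ℕ := min (i : ℕ) (v - i)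

/-- `u_i = i - m(v)_i + r_i` (the subtraction never truncates). -/
def uVec {v : ℕ} (r : Idx v → ℕ) (i : Idx v) : ℕ := (i : ℕ) - mVec v i + r i

theorem uVec_eq {v : ℕ} (r : Idx v → ℕ) (i : Idx v) :
    (uVec r i : ℤ) = max (2 * (i : ℤ) - v) 0 + r i := by
  have := i.2
  simp only [Finset.mem_Ioo] at this
  unfold uVec mVec
  omega

/-- `ū_j = max ({u_i | 1 ≤ i ≤ j} ∪ {u_i - 2 (i - j) | j < i < v})`. -/
def uBar {v : ℕ} (r : Idx v → ℕ) (j : Idx v) : ℤ :=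
  Finset.univ.sup' ⟨j, Finset.mem_univ j⟩ fun i : Idx v =>
    if i ≤ j then (uVec r i : ℤ) else (uVec r i : ℤ) - 2 * ((i : ℤ) - (j : ℤ))

/-- `r̄_j = ū_j - j + m(v)_j`. -/
def rBar {v : ℕ} (r : Idx v → ℕ) (j : Idx v) : ℤ := uBar r j - (j : ℤ) + mVec v j

/-- The index set `I = {1 ≤ i ≤ v - 1 | r_i > 0}`. -/
abbrev Supp {v : ℕ} (r : Idx v → ℕ) := {i : Idx v // 0 < r i}

/-- The set of weakly increasing families `(U_i)_{i ∈ I}` of subspaces of `K ^ v` with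
`dim U_i = i - m(v)_i + r_i` for all `i ∈ I`. -/
def chains (K : Type*) [Field K] {v : ℕ} (r : Idx v → ℕ) :
    Set (Supp r → Submodule K (Fin v → K)) :=
  {U | Monotone U ∧ ∀ i : Supp r, Module.finrank K (U i) = uVec r i}

/-- The chains as above with moreover `U_i ≤ W'_i` for all `i ∈ I`, for a full flag `W'`. -/
def chainsIn {K : Type*} [Field K] {v : ℕ} (r : Idx v → ℕ) (L : FullFlag K v) :
    Set (Supp r → Submodule K (Fin v → K)) :=
  {U | U ∈ chains K r ∧ ∀ i : Supp r, U i ≤ L.W i}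

/-- The Gaussian binomial coefficient `∏_{i=1}^{k} (q^(n-k+i) - 1) / (q^i - 1)`, for `k ≤ n`
(for `k > n` the factor with `i = k - n` makes it `0`). -/
def gaussBinom (q n k : ℕ) : ℚ :=
  ∏ i ∈ Finset.Icc 1 k, ((q : ℚ) ^ (n + i - k) - 1) / ((q : ℚ) ^ i - 1)

end FlagCode

/-! This is a packing bound. If two codewords contain a common chain, then `U i ≤ W_i ⊓ W'_i`, so
`dim (W_i ⊓ W'_i) ≥ u_i` for `i ∈ I`; for `r i = 0` this bound holds for any two flags. These
intersections grow with `i` and shrink by at most 2 per step down, hence `dim (W_j ⊓ W'_j) ≥ ū_j`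
for all `j`. As `j - ū_j = m(v)_j - r̄_j`, the distance is then less than `d`
(`grassmannDist_le_of_mem_chainsIn`). So the sets `chainsIn r L`, for codewords `L`, are disjoint
subsets of `chains K r`. All these sets have the same size: building a chain from the bottom, the
number of choices for the next member is a Gaussian binomial depending only on dimensions
(`card_boundedChains`). The same count gives `chains K r`, and the quotient is the bound. -/

namespace FlagCode

open Module

/-! ### Counting subspaces and chains of subspaces over a finite field. -/

section Counting

variable {K V : Type*} [Field K] [Finite K] [AddCommGroup V] [Module K V] [Finite V]

/-- Division-free form, matching the counts of independent `k`-tuples in dimensions `k` and `n`. The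
powers `q ^ i` split off both products and cancel. -/
theorem gaussBinom_mul_prod {q n k : ℕ} (hq : 1 < q) (hk : k ≤ n) :
    gaussBinom q n k * ∏ i : Fin k, ((q : ℚ) ^ k - (q : ℚ) ^ (i : ℕ)) =
      ∏ i : Fin k, ((q : ℚ) ^ n - (q : ℚ) ^ (i : ℕ)) := by
  have hq' : (1 : ℚ) < q := by exact_mod_cast hq
  have hflip : gaussBinom q n k =
      ∏ i : Fin k, ((q : ℚ) ^ (n - (i : ℕ)) - 1) / ((q : ℚ) ^ (k - (i : ℕ)) - 1) := by
    rw [Fin.prod_univ_eq_prod_range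
      (fun i => ((q : ℚ) ^ (n - i) - 1) / ((q : ℚ) ^ (k - i) - 1)) k, gaussBinom]
    refine Finset.prod_nbij' (fun i => k - i) (fun i => k - i) ?_ ?_ ?_ ?_ ?_
    · intro i hi; simp only [Finset.mem_Icc, Finset.mem_range] at *; omega
    · intro i hi; simp only [Finset.mem_Icc, Finset.mem_range] at *; omega
    · intro i hi; simp only [Finset.mem_Icc] at *; omega
    · intro i hi; simp only [Finset.mem_range] at *; omega
    · intro i hi
      simp only [Finset.mem_Icc] at hi
      rw [show n - (k - i) = n + i - k by omega, show k - (k - i) = i by omega]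
  rw [hflip, ← Finset.prod_mul_distrib]
  refine Finset.prod_congr rfl fun i _ => ?_
  have hi := i.2
  have h1 : (q : ℚ) ^ (k - (i : ℕ)) - 1 ≠ 0 :=
    (sub_pos.2 (one_lt_pow₀ hq' (by omega))).ne'
  have hsplit : ∀ m : ℕ, (i : ℕ) ≤ m →
      (q : ℚ) ^ m - (q : ℚ) ^ (i : ℕ) = (q : ℚ) ^ (i : ℕ) * ((q : ℚ) ^ (m - (i : ℕ)) - 1) := by
    intro m hm
    rw [mul_sub, ← pow_add, mul_one, Nat.add_sub_cancel' hm]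
  rw [hsplit k hi.le, hsplit n (by omega)]
  field_simp

/-- Linearly independent `k`-tuples, sorted by the subspace that they span. -/
def linearIndependentEquivSigma (K V : Type*) [Field K] [AddCommGroup V] [Module K V] [Finite V]
    (k : ℕ) :
    {s : Fin k → V // LinearIndependent K s} ≃
      Σ S : {S : Submodule K V // finrank K S = k},
        {t : Fin k → S.1 // LinearIndependent K t} where
  toFun s := ⟨⟨Submodule.span K (Set.range s.1), by simp [finrank_span_eq_card s.2]⟩,
    ⟨fun i => ⟨s.1 i, Submodule.subset_span ⟨i, rfl⟩⟩,
      LinearIndependent.of_comp (Submodule.subtype _) s.2⟩⟩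
  invFun p := ⟨fun i => p.2.1 i, p.2.2.map' (Submodule.subtype _) (Submodule.ker_subtype _)⟩
  left_inv s := rfl
  right_inv := by
    rintro ⟨⟨S, hS⟩, ⟨(t : Fin k → S), ht⟩⟩
    have ht' : LinearIndependent K fun i => (t i : V) :=
      ht.map' (Submodule.subtype _) (Submodule.ker_subtype _)
    have hspan : Submodule.span K (Set.range fun i => (t i : V)) = S := by
      refine Submodule.eq_of_le_of_finrank_eq (Submodule.span_le.2 ?_) ?_
      · rintro _ ⟨i, rfl⟩
        exact (t i).2
      · rw [finrank_span_eq_card ht', hS, Fintype.card_fin]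
    refine Sigma.ext (Subtype.ext hspan) ?_
    -- The span is generalised to a variable `S'`, so that its equality with `S` can be substituted
    -- in the fibre type.
    have hheq : ∀ (S' : Submodule K V) (t' : Fin k → S')
        (ht' : LinearIndependent K t'), S' = S → (∀ i, (t' i : V) = t i) →
        HEq (⟨t', ht'⟩ : {t : Fin k → S' // LinearIndependent K t})
          (⟨t, ht⟩ : {t : Fin k → S // LinearIndependent K t}) := by
      rintro S' t' ht' rfl h
      exact heq_of_eq (Subtype.ext (funext fun i => Subtype.ext (h i)))
    exact hheq _ _ _ hspan fun i => rfl

/-- Independent `k`-tuples are counted by their span: every `k`-dimensional subspace has equally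
many ordered bases. -/
theorem card_submodule_finrank_eq {k : ℕ} (hk : k ≤ finrank K V) :
    (Nat.card {S : Submodule K V // finrank K S = k} : ℚ) =
      gaussBinom (Nat.card K) (finrank K V) k := by
  have := Fintype.ofFinite K
  have hq : 1 < Nat.card K := Finite.one_lt_card
  have hcast : ∀ m : ℕ, k ≤ m →
      ((∏ i : Fin k, (Fintype.card K ^ m - Fintype.card K ^ i.val) : ℕ) : ℚ) =
        ∏ i : Fin k, ((Nat.card K : ℚ) ^ m - (Nat.card K : ℚ) ^ (i : ℕ)) := by
    intro m hm
    rw [Nat.cast_prod]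
    refine Finset.prod_congr rfl fun i _ => ?_
    rw [Nat.cast_sub (Nat.pow_le_pow_right Fintype.card_pos (by omega)), Nat.card_eq_fintype_card]
    push_cast
    rfl
  have hcount := Nat.card_congr (linearIndependentEquivSigma K V k)
  have := Fintype.ofFinite {S : Submodule K V // finrank K S = k}
  have hfib : ∀ S : {S : Submodule K V // finrank K S = k},
      Nat.card {t : Fin k → S.1 // LinearIndependent K t} =
        ∏ i : Fin k, (Fintype.card K ^ k - Fintype.card K ^ i.val) := by
    intro S
    rw [card_linearIndependent S.2.ge, S.2]
  rw [card_linearIndependent hk, Nat.card_sigma, Finset.sum_congr rfl fun S _ => hfib S,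
    Finset.sum_const, smul_eq_mul, Finset.card_univ, 
    ← Nat.card_eq_fintype_card (α := {S : Submodule K V // finrank K S = k})] at hcount
  have hcount' := congrArg (Nat.cast : ℕ → ℚ) hcount
  rw [Nat.cast_mul, hcast _ hk, hcast k le_rfl, ← gaussBinom_mul_prod hq hk] at hcount'
  refine (mul_right_cancel₀ ?_ hcount').symm
  refine Finset.prod_ne_zero_iff.2 fun i _ => (sub_pos.2 ?_).ne'
  exact pow_lt_pow_right₀ (by exact_mod_cast hq) i.2

/-- Subspaces above `X` correspond to subspaces of `V ⧸ X`, with dimensions lowered by `dim X`. -/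
theorem card_submodule_ge_finrank_eq (X : Submodule K V) {k : ℕ} (hX : finrank K X ≤ k)
    (hk : k ≤ finrank K V) :
    (Nat.card {S : Submodule K V // X ≤ S ∧ finrank K S = k} : ℚ) =
      gaussBinom (Nat.card K) (finrank K V - finrank K X) (k - finrank K X) := by
  have hquot := X.finrank_quotient_add_finrank
  have : Finite (V ⧸ X) := Finite.of_surjective _ X.mkQ_surjective
  rw [show finrank K V - finrank K X = finrank K (V ⧸ X) by omega,
    ← card_submodule_finrank_eq (by omega)]
  congr 1
  have hcomap : ∀ T : Submodule K (V ⧸ X),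
      finrank K (T.comap X.mkQ) = finrank K T + finrank K X := by
    intro T
    have h := (X.mkQ.domRestrict (T.comap X.mkQ)).finrank_range_add_finrank_ker
    have hle : X ≤ T.comap X.mkQ := by
      intro x hx
      simp [(Submodule.Quotient.mk_eq_zero X).2 hx]
    rw [LinearMap.range_domRestrict, Submodule.map_comap_eq_of_surjective X.mkQ_surjective,
      LinearMap.ker_domRestrict, Submodule.ker_mkQ] at h
    rw [← h, ← (Submodule.submoduleOfEquivOfLe hle).finrank_eq]
    rfl
  refine Nat.card_congr (Equiv.symm ?_)
  refine Equiv.trans (Equiv.subtypeEquiv (p := fun T : Submodule K (V ⧸ X) => _)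
    (q := fun S : Set.Ici X => finrank K S.1 = k) (Submodule.comapMkQRelIso X).toEquiv ?_)
    (Equiv.subtypeSubtypeEquivSubtypeInter (fun S => X ≤ S) (fun S => finrank K S = k))
  intro T
  change _ ↔ finrank K (T.comap X.mkQ) = k
  rw [hcomap]
  omega

theorem card_submodule_Icc_finrank_eq {X Y : Submodule K V} (hXY : X ≤ Y) {k : ℕ}
    (hX : finrank K X ≤ k) (hk : k ≤ finrank K Y) :
    (Nat.card {S : Submodule K V // X ≤ S ∧ finrank K S = k ∧ S ≤ Y} : ℚ) =
      gaussBinom (Nat.card K) (finrank K Y - finrank K X) (k - finrank K X) := by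
  have hX' : finrank K (X.submoduleOf Y) = finrank K X :=
    (Submodule.submoduleOfEquivOfLe hXY).finrank_eq
  have h := card_submodule_ge_finrank_eq (X.submoduleOf Y) (hX'.trans_le hX) hk
  rw [hX'] at h
  rw [← h]
  congr 1
  refine Nat.card_congr (Equiv.symm ?_)
  refine (Equiv.subtypeEquiv (p := fun T : Submodule K Y => _)
    (q := fun S : {S : Submodule K V // S ≤ Y} => X ≤ S.1 ∧ finrank K S.1 = k)
    (Submodule.MapSubtype.orderIso Y).toEquiv ?_).trans
    ((Equiv.subtypeSubtypeEquivSubtypeInter _ (fun S => X ≤ S ∧ finrank K S = k)).trans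
      (Equiv.subtypeEquivRight fun S => by tauto))
  intro T
  change _ ↔ X ≤ T.map Y.subtype ∧ finrank K (T.map Y.subtype) = k
  rw [Submodule.finrank_map_subtype_eq, ← Submodule.comap_le_comap_iff_of_le_range (f := Y.subtype),
    Submodule.comap_map_eq_of_injective Y.subtype_injective]
  · rfl
  · simpa using hXY

/-- The weakly increasing sequences of subspaces `U i ≤ A i` with `dim U i = u i`. -/
def boundedChains {n : ℕ} (A : Fin n → Submodule K V) (u : Fin n → ℕ) :
    Set (Fin n → Submodule K V) :=
  {U | Monotone U ∧ (∀ i, finrank K (U i) = u i) ∧ ∀ i, U i ≤ A i}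

/-- A bounded chain is a shorter bounded chain together with its last member. -/
def boundedChainsSuccEquiv {n : ℕ} (A : Fin (n + 2) → Submodule K V) (u : Fin (n + 2) → ℕ) :
    boundedChains A u ≃
      Σ U : boundedChains (fun i : Fin (n + 1) => A i.castSucc) (fun i => u i.castSucc),
        {S : Submodule K V // U.1 (Fin.last n) ≤ S ∧ finrank K S = u (Fin.last (n + 1)) ∧
          S ≤ A (Fin.last (n + 1))} where
  toFun U := ⟨⟨fun i => U.1 i.castSucc, U.2.1.comp Fin.strictMono_castSucc.monotone,
      fun i => U.2.2.1 _, fun i => U.2.2.2 _⟩,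
    ⟨U.1 (Fin.last (n + 1)), U.2.1 (Fin.le_last _), U.2.2.1 _, U.2.2.2 _⟩⟩
  invFun p := ⟨Fin.snoc (α := fun _ => Submodule K V) p.1.1 p.2.1, by
    refine ⟨Fin.monotone_iff_le_succ.2 fun i => ?_, fun i => ?_, fun i => ?_⟩
    · rw [Fin.snoc_castSucc]
      induction i using Fin.lastCases with
      | last => rw [Fin.succ_last, Fin.snoc_last]; exact p.2.2.1
      | cast i =>
        rw [Fin.succ_castSucc, Fin.snoc_castSucc]
        exact p.1.2.1 (Fin.castSucc_lt_succ).le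
    · induction i using Fin.lastCases with
      | last => rw [Fin.snoc_last]; exact p.2.2.2.1
      | cast i => rw [Fin.snoc_castSucc]; exact p.1.2.2.1 i
    · induction i using Fin.lastCases with
      | last => rw [Fin.snoc_last]; exact p.2.2.2.2
      | cast i => rw [Fin.snoc_castSucc]; exact p.1.2.2.2 i⟩
  left_inv U := Subtype.ext (Fin.snoc_init_self U.1)
  right_inv := by
    rintro ⟨⟨U, hU⟩, ⟨S, hS⟩⟩
    have h : (fun i : Fin (n + 1) => Fin.snoc (α := fun _ => Submodule K V) U S i.castSucc) = U :=
      funext fun i => Fin.snoc_castSucc (α := fun _ => Submodule K V) _ _ _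
    have h' : Fin.snoc (α := fun _ => Submodule K V) U S (Fin.last (n + 1)) = S :=
      Fin.snoc_last (α := fun _ => Submodule K V) _ _
    refine Sigma.ext (Subtype.ext h) ?_
    refine (Subtype.heq_iff_coe_eq ?_).2 h'
    intro T
    exact (congrArg (fun U' : Fin (n + 1) → Submodule K V => U' (Fin.last n) ≤ T ∧ _) h).to_iff

/-- Induction on the length. Since `A` is monotone, the last but one member lies in the last bound,
so the choices for the last member form an interval count that is the same for every shorter chain.
-/
theorem card_boundedChains {n : ℕ} {A : Fin (n + 1) → Submodule K V} {u : Fin (n + 1) → ℕ}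
    (hA : Monotone A) (hu : Monotone u) (huA : ∀ i, u i ≤ finrank K (A i)) :
    (Nat.card (boundedChains A u) : ℚ) =
      gaussBinom (Nat.card K) (finrank K (A 0)) (u 0) *
        ∏ i : Fin n, gaussBinom (Nat.card K) (finrank K (A i.succ) - u i.castSucc)
          (u i.succ - u i.castSucc) := by
  induction n with
  | zero =>
    have h := card_submodule_Icc_finrank_eq (K := K) (V := V) (X := ⊥) (Y := A 0) bot_le
      (k := u 0) (by simp) (huA 0)
    rw [finrank_bot, Nat.sub_zero, Nat.sub_zero] at h
    rw [Finset.univ_eq_empty, Finset.prod_empty, mul_one, ← h]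
    congr 1
    refine Nat.card_congr (Equiv.subtypeEquiv (Equiv.funUnique (Fin 1) (Submodule K V)) ?_)
    intro U
    refine ⟨fun hU => ⟨bot_le, hU.2.1 0, hU.2.2 0⟩, fun hU => ⟨?_, ?_, ?_⟩⟩
    · exact Subsingleton.monotone (α := Fin 1) U
    · exact Fin.forall_fin_one.2 hU.2.1
    · exact Fin.forall_fin_one.2 hU.2.2
  | succ n ih =>
    have ih := ih (A := fun i => A i.castSucc) (u := fun i => u i.castSucc) (hA.comp Fin.strictMono_castSucc.monotone)
      (hu.comp Fin.strictMono_castSucc.monotone) fun i => huA i.castSucc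
    have hle : u (Fin.last n).castSucc ≤ u (Fin.last (n + 1)) := hu (Fin.le_last _)
    have hfib : ∀ U : boundedChains (fun i : Fin (n + 1) => A i.castSucc) (fun i => u i.castSucc),
        (Nat.card {S : Submodule K V // U.1 (Fin.last n) ≤ S ∧
          finrank K S = u (Fin.last (n + 1)) ∧ S ≤ A (Fin.last (n + 1))} : ℚ) =
        gaussBinom (Nat.card K) (finrank K (A (Fin.last (n + 1))) - u (Fin.last n).castSucc)
          (u (Fin.last (n + 1)) - u (Fin.last n).castSucc) := by
      intro U
      have hd := U.2.2.1 (Fin.last n)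
      rw [card_submodule_Icc_finrank_eq ((U.2.2.2 _).trans (hA (Fin.le_last _)))
        (hd.trans_le hle) (huA _), hd]
    have := Fintype.ofFinite
      (boundedChains (fun i : Fin (n + 1) => A i.castSucc) (fun i => u i.castSucc))
    rw [Nat.card_congr (boundedChainsSuccEquiv A u), Nat.card_sigma, Nat.cast_sum,
      Finset.sum_congr rfl fun U _ => hfib U, Finset.sum_const, Finset.card_univ,
      ← Nat.card_eq_fintype_card, nsmul_eq_mul, ih, Fin.prod_univ_castSucc, mul_assoc]
    rfl

end Counting

/-! ### Flags sharing a chain are close. -/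

section Codes

variable {K : Type*} [Field K] {v : ℕ} {r : Idx v → ℕ}

theorem Idx.pos_and_lt (i : Idx v) : 0 < (i : ℕ) ∧ (i : ℕ) < v := Finset.mem_Ioo.1 i.2

theorem uVec_le (hr : ∀ i, r i ≤ mVec v i) (i : Idx v) : uVec r i ≤ i := by
  have := hr i
  unfold uVec mVec at *
  omega

theorem chainsIn_nonempty (hr : ∀ i, r i ≤ mVec v i)
    (hu : ∀ i j : Supp r, i ≤ j → uVec r i ≤ uVec r j) (L : FullFlag K v) :
    (chainsIn r L).Nonempty := by
  -- The witness takes `U i` to be the member of the flag of dimension `u_i`; this index is positive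
  -- because `r i > 0`.
  have hmem : ∀ i : Supp r, uVec r i ∈ Finset.Ioo 0 v := fun i => by
    have h1 := uVec_le hr i.1
    have h2 := i.2
    have h3 := Idx.pos_and_lt i.1
    rw [Finset.mem_Ioo]
    unfold uVec at *
    omega
  refine ⟨fun i => L.W ⟨uVec r i, hmem i⟩, ⟨fun i j hij => ?_, fun i => ?_⟩, fun i => ?_⟩
  · exact L.strictMono.monotone (hu i j hij)
  · exact L.finrank_eq _
  · exact L.strictMono.monotone (uVec_le hr i.1)

/-- On the support, `U i` itself lies in the intersection. Elsewhere `u_i = max (2 i - v) 0`, which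
is the dimension formula in `K ^ v`. -/
theorem uVec_le_finrank_inf {L L' : FullFlag K v} {U : Supp r → Submodule K (Fin v → K)}
    (hU : U ∈ chainsIn r L) (hU' : U ∈ chainsIn r L') (i : Idx v) :
    uVec r i ≤ finrank K (L.W i ⊓ L'.W i : Submodule K (Fin v → K)) := by
  by_cases hi : 0 < r i
  · rw [← hU.1.2 ⟨i, hi⟩]
    exact Submodule.finrank_mono (le_inf (hU.2 ⟨i, hi⟩) (hU'.2 ⟨i, hi⟩))
  · have h1 := Submodule.finrank_sup_add_finrank_inf_eq (L.W i) (L'.W i)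
    have h2 := Submodule.finrank_le (L.W i ⊔ L'.W i)
    rw [L.finrank_eq, L'.finrank_eq] at h1
    rw [finrank_fin_fun] at h2
    unfold uVec mVec
    omega

/-- Passing from `W_i ⊓ W'_i` down to `W_j ⊓ W'_j` loses at most `2 (i - j)` dimensions. -/
theorem finrank_inf_le_finrank_inf_add {L L' : FullFlag K v} {i j : Idx v} (hij : j ≤ i) :
    finrank K (L.W i ⊓ L'.W i : Submodule K (Fin v → K)) ≤
      finrank K (L.W j ⊓ L'.W j : Submodule K (Fin v → K)) + 2 * ((i : ℕ) - j) := by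
  -- Shrinking one factor of an intersection from `Y` to `X` costs at most `dim Y - dim X`.
  -- Shrinking each flag's member once gives the factor 2.
  have key : ∀ S X Y : Submodule K (Fin v → K), X ≤ Y →
      finrank K (S ⊓ Y : Submodule K (Fin v → K)) + finrank K X ≤
        finrank K (S ⊓ X : Submodule K (Fin v → K)) + finrank K Y := by
    intro S X Y hXY
    have h := Submodule.finrank_sup_add_finrank_inf_eq (S ⊓ Y) X
    rw [inf_assoc, inf_eq_right.2 hXY] at h
    have := Submodule.finrank_mono (sup_le inf_le_right hXY : S ⊓ Y ⊔ X ≤ Y)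
    omega
  have hW := L.strictMono.monotone hij
  have hW' := L'.strictMono.monotone hij
  have h1 := key (L.W i) _ _ hW'
  have h2 := key (L'.W j) _ _ hW
  rw [inf_comm, inf_comm (L'.W j)] at h2
  rw [L.finrank_eq, L.finrank_eq] at h2
  rw [L'.finrank_eq, L'.finrank_eq] at h1
  have : (j : ℕ) ≤ i := hij
  omega

/-- Each term of the maximum carries the bound at `i` over to `j`: upwards by monotonicity,
downwards with a loss of `2 (i - j)`. -/
theorem uBar_le_finrank_inf {L L' : FullFlag K v} {U : Supp r → Submodule K (Fin v → K)}
    (hU : U ∈ chainsIn r L) (hU' : U ∈ chainsIn r L') (j : Idx v) :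
    uBar r j ≤ finrank K (L.W j ⊓ L'.W j : Submodule K (Fin v → K)) := by
  refine Finset.sup'_le _ _ fun i _ => ?_
  have hi := uVec_le_finrank_inf hU hU' i
  split_ifs with hij
  · exact_mod_cast hi.trans (Submodule.finrank_mono
      (inf_le_inf (L.strictMono.monotone hij) (L'.strictMono.monotone hij)))
  · have hji : j ≤ i := (not_le.1 hij).le
    have h := finrank_inf_le_finrank_inf_add (L := L) (L' := L') hji
    have : (j : ℕ) ≤ i := hji
    omega

theorem grassmannDist_le_of_mem_chainsIn {L L' : FullFlag K v}
    {U : Supp r → Submodule K (Fin v → K)} (hU : U ∈ chainsIn r L) (hU' : U ∈ chainsIn r L') :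
    (grassmannDist L L' : ℤ) ≤ ∑ i : Idx v, ((mVec v i : ℤ) - rBar r i) := by
  unfold grassmannDist
  rw [Nat.cast_sum]
  refine Finset.sum_le_sum fun i _ => ?_
  have h1 := uBar_le_finrank_inf hU hU' i
  have h2 : finrank K (L.W i ⊓ L'.W i : Submodule K (Fin v → K)) ≤ i :=
    (Submodule.finrank_mono inf_le_left).trans_eq (L.finrank_eq i)
  unfold rBar
  omega

theorem eq_of_mem_chainsIn {d : ℕ}
    (hd : ∑ i : Idx v, ((mVec v i : ℤ) - rBar r i) < (d : ℤ)) {C : Set (FullFlag K v)}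
    (hC : (d : ℕ∞) ≤ minDist C) {L L' : FullFlag K v} (hL : L ∈ C) (hL' : L' ∈ C)
    {U : Supp r → Submodule K (Fin v → K)} (hU : U ∈ chainsIn r L) (hU' : U ∈ chainsIn r L') :
    L = L' := by
  by_contra hne
  have h : (d : ℕ∞) ≤ grassmannDist L L' :=
    hC.trans (iInf₂_le_of_le L hL (iInf₂_le_of_le L' hL' (iInf_le _ hne)))
  have h' : d ≤ grassmannDist L L' := by exact_mod_cast h
  have := grassmannDist_le_of_mem_chainsIn hU hU'
  omega

theorem chains_eq_univ_of_isEmpty [IsEmpty (Supp r)] : chains K r = Set.univ :=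
  Set.eq_univ_of_forall fun _ => ⟨fun i => isEmptyElim i, fun i => isEmptyElim i⟩

theorem chainsIn_eq_univ_of_isEmpty [IsEmpty (Supp r)] (L : FullFlag K v) :
    chainsIn r L = Set.univ := by
  refine Set.eq_univ_of_forall fun U => ⟨?_, fun i => isEmptyElim i⟩
  rw [chains_eq_univ_of_isEmpty]
  trivial

/-! ### The packing bound and the sizes of the chain sets. -/

variable [Finite K]

theorem mul_ncard_le_ncard_chains {d N : ℕ}
    (hd : ∑ i : Idx v, ((mVec v i : ℤ) - rBar r i) < (d : ℤ))
    (hN : ∀ L : FullFlag K v, (chainsIn r L).ncard = N) {C : Set (FullFlag K v)}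
    (hC : (d : ℕ∞) ≤ minDist C) : C.ncard * N ≤ (chains K r).ncard := by
  -- Disjointness: the chain `U` determines the codeword `L` containing it.
  have hinj : Function.Injective
      (fun p : Σ L : C, chainsIn r L.1 => (⟨p.2.1, p.2.2.1⟩ : chains K r)) := by
    rintro ⟨⟨L, hL⟩, ⟨U, hU⟩⟩ ⟨⟨L', hL'⟩, ⟨U', hU'⟩⟩ h
    obtain rfl : U = U' := congrArg Subtype.val h
    obtain rfl := eq_of_mem_chainsIn hd hC hL hL' hU hU'
    rfl
  have h := Nat.card_le_card_of_injective _ hinj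
  have := Fintype.ofFinite C
  rwa [Nat.card_sigma, Finset.sum_congr rfl fun L _ => (Nat.card_coe_set_eq _).trans (hN L.1),
    Finset.sum_const, Finset.card_univ, ← Nat.card_eq_fintype_card, Nat.card_coe_set_eq,
    Nat.card_coe_set_eq, smul_eq_mul] at h

/-- Serves both counts: the constant bound `⊤` gives all chains, the bound `L.W` those inside the
flag. -/
theorem ncard_eq_of_orderIso {n : ℕ} (e : Fin (n + 1) ≃o Supp r)
    (A : Idx v → Submodule K (Fin v → K)) (hA : Monotone A)
    (hu : ∀ i j : Supp r, i ≤ j → uVec r i ≤ uVec r j)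
    (huA : ∀ i, uVec r i ≤ finrank K (A i)) :
    ({U | U ∈ chains K r ∧ ∀ i : Supp r, U i ≤ A i}.ncard : ℚ) =
      gaussBinom (Nat.card K) (finrank K (A (e 0))) (uVec r (e 0)) *
        ∏ i : Fin n, gaussBinom (Nat.card K) (finrank K (A (e i.succ)) - uVec r (e i.castSucc))
          (uVec r (e i.succ) - uVec r (e i.castSucc)) := by
  have hval : Monotone fun i => (e i).1 := fun i j hij => e.monotone hij
  rw [← card_boundedChains (A := fun i => A (e i)) (u := fun i => uVec r (e i)) (hA.comp hval)
    (fun i j hij => hu _ _ (e.monotone hij)) fun i => huA _, ← Nat.card_coe_set_eq]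
  congr 1
  refine Nat.card_congr (Equiv.subtypeEquiv (e.toEquiv.symm.arrowCongr (Equiv.refl _)) ?_)
  intro U
  change (Monotone U ∧ _) ∧ _ ↔ Monotone (U ∘ e) ∧
    (∀ i, finrank K (U (e i)) = uVec r (e i)) ∧ ∀ i, U (e i) ≤ A (e i)
  rw [e.surjective.forall (p := fun i => U i ≤ A i), and_assoc,
    e.surjective.forall (p := fun i => finrank K (U i) = uVec r i)]
  refine and_congr_left fun _ => ⟨fun h => h.comp e.monotone, fun h => ?_⟩
  simpa [Function.comp_def] using h.comp e.symm.monotone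

theorem ncard_chains {n : ℕ} (e : Fin (n + 1) ≃o Supp r) (hr : ∀ i, r i ≤ mVec v i)
    (hu : ∀ i j : Supp r, i ≤ j → uVec r i ≤ uVec r j) :
    ((chains K r).ncard : ℚ) =
      gaussBinom (Nat.card K) v (uVec r (e 0)) *
        ∏ i : Fin n, gaussBinom (Nat.card K) (v - uVec r (e i.castSucc))
          (uVec r (e i.succ) - uVec r (e i.castSucc)) := by
  have h := ncard_eq_of_orderIso (K := K) e (fun _ => ⊤) monotone_const hu fun i => by
    rw [finrank_top, finrank_fin_fun]
    exact (uVec_le hr i).trans (Idx.pos_and_lt i).2.le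
  simpa [finrank_top, finrank_fin_fun] using h

theorem ncard_chainsIn {n : ℕ} (e : Fin (n + 1) ≃o Supp r) (hr : ∀ i, r i ≤ mVec v i)
    (hu : ∀ i j : Supp r, i ≤ j → uVec r i ≤ uVec r j) (L : FullFlag K v) :
    ((chainsIn r L).ncard : ℚ) =
      gaussBinom (Nat.card K) (e 0 : Idx v) (uVec r (e 0)) *
        ∏ i : Fin n, gaussBinom (Nat.card K) (((e i.succ : Idx v) : ℕ) - uVec r (e i.castSucc))
          (uVec r (e i.succ) - uVec r (e i.castSucc)) := by
  have h := ncard_eq_of_orderIso e L.W L.strictMono.monotone hu fun i => by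
    rw [L.finrank_eq]
    exact uVec_le hr i
  simp only [L.finrank_eq] at h
  exact h

/-- The count involves only the dimensions in the flag. An empty support is separate, since the
formula needs a first index. -/
theorem ncard_chainsIn_eq_ncard_chainsIn (hr : ∀ i, r i ≤ mVec v i)
    (hu : ∀ i j : Supp r, i ≤ j → uVec r i ≤ uVec r j) (L L' : FullFlag K v) :
    (chainsIn r L).ncard = (chainsIn r L').ncard := by
  rcases isEmpty_or_nonempty (Supp r) with h | h
  · rw [chainsIn_eq_univ_of_isEmpty, chainsIn_eq_univ_of_isEmpty]
  · obtain ⟨n, hn⟩ := Nat.exists_eq_succ_of_ne_zero (Fintype.card_ne_zero (α := Supp r))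
    have e : Fin (n + 1) ≃o Supp r := Fintype.orderIsoFinOfCardEq _ hn
    have h := (ncard_chainsIn e hr hu L).trans (ncard_chainsIn e hr hu L').symm
    exact_mod_cast h

end Codes

end FlagCode

theorem mainTheorem2 {K : Type*} [Field K] [Finite K] (q : ℕ) (hq : Nat.card K = q)
    (v d : ℕ) (r : FlagCode.Idx v → ℕ) (hr : ∀ i, r i ≤ FlagCode.mVec v i)
    (hd : ∑ i : FlagCode.Idx v, ((FlagCode.mVec v i : ℤ) - FlagCode.rBar r i) < (d : ℤ))
    (hu : ∀ i j : FlagCode.Supp r, i ≤ j → FlagCode.uVec r i ≤ FlagCode.uVec r j)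
    (L : FlagCode.FullFlag K v) :
    0 < (FlagCode.chainsIn r L).ncard ∧
    (FlagCode.maxCode K v d : ℚ) ≤
      ((FlagCode.chains K r).ncard : ℚ) / ((FlagCode.chainsIn r L).ncard : ℚ) ∧
    (IsEmpty (FlagCode.Supp r) →
      ((FlagCode.chains K r).ncard : ℚ) / ((FlagCode.chainsIn r L).ncard : ℚ) = 1) ∧
    (∀ (n : ℕ) (k : Fin (n + 1) → FlagCode.Idx v), StrictMono k →
      Set.range k = {i | 0 < r i} →
      ((FlagCode.chains K r).ncard : ℚ) / ((FlagCode.chainsIn r L).ncard : ℚ) =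
        (FlagCode.gaussBinom q v (FlagCode.uVec r (k 0)) *
          ∏ i : Fin n, FlagCode.gaussBinom q (v - FlagCode.uVec r (k i.castSucc))
            (FlagCode.uVec r (k i.succ) - FlagCode.uVec r (k i.castSucc))) /
        (FlagCode.gaussBinom q (k 0) (FlagCode.uVec r (k 0)) *
          ∏ i : Fin n, FlagCode.gaussBinom q ((k i.succ : ℕ) - FlagCode.uVec r (k i.castSucc))
            (FlagCode.uVec r (k i.succ) - FlagCode.uVec r (k i.castSucc)))) := by
  subst hq
  have hpos : 0 < (FlagCode.chainsIn r L).ncard :=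
    (Set.ncard_pos (Set.toFinite _)).2 (FlagCode.chainsIn_nonempty hr hu L)
  have hpos' : (0 : ℚ) < (FlagCode.chainsIn r L).ncard := by exact_mod_cast hpos
  refine ⟨hpos, ?_, fun hempty => ?_, fun n k hk hrange => ?_⟩
  · rw [le_div_iff₀ hpos']
    obtain ⟨C, hCcard, hC⟩ := (FlagCode.isGreatest_maxCode K v d).1
    rw [← hCcard]
    exact_mod_cast FlagCode.mul_ncard_le_ncard_chains hd
      (fun L' => FlagCode.ncard_chainsIn_eq_ncard_chainsIn hr hu L' L) hC
  · rw [FlagCode.chains_eq_univ_of_isEmpty, ← FlagCode.chainsIn_eq_univ_of_isEmpty L]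
    exact div_self hpos'.ne'
  · have hmem : ∀ i, i ∈ Set.range k ↔ 0 < r i := fun i => by rw [hrange]; rfl
    -- Built so that `e i` has underlying index `k i` by definition; hence the closing `rfl`.
    let e : Fin (n + 1) ≃o FlagCode.Supp r := hk.orderIso.trans
      { Equiv.subtypeEquivRight hmem with map_rel_iff' := Iff.rfl }
    rw [FlagCode.ncard_chains e hr hu, FlagCode.ncard_chainsIn e hr hu L]
    rfl
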